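/- Call a set $X$ of unit vectors in $\mathbb{R}^n$ (with the standard inner product) an equiangular set with angle $\alpha\in[0,1)$ if $\langle x,y\rangle\in\{\alpha,-\alpha\}$ for all distinct $x,y\in X$. The lines $\mathbb{R}x$, $x\in X$, are then $|X|$ distinct equiangular lines, any two of which meet at the angle $\arccos\alpha$. The rank of $X$ is the dimension of the linear span of $X$. 1. For every $n$, every equiangular set $X\subset\mathbb{R}^n$ with angle $\frac13$ and rank $8$ satisfies $|X|\le 14$. That is, there are at most $14$ equiangular lines with angle $\frac13$ of rank $8$. 2. The bound is attained: there is an equiangular set in $\mathbb{R}^8$ with angle $\frac13$, rank $8$ and exactly $14$ elements. 3. The maximum configuration is unique up to isomorphism: if $X\subset\mathbb{R}^m$ and $Y\subset\mathbb{R}^n$ are equiangular sets with angle $\frac13$, rank $8$ and exactly $14$ elements, then there is a linear isometry from the span of $X$ onto the span of $Y$ that maps the set of lines $\{\mathbb{R}x : x\in X\}$ onto the set of lines $\{\mathbb{R}y : y\in Y\}$. -/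

import Mathlib

/-- `X` is an equiangular set with angle `α` (that is, the lines through its members pairwise form
the angle `arccos α`): `α ∈ [0, 1)`, the members of `X` are unit vectors, and distinct members have
inner product `α` or `-α`.  As `α < 1`, no two members span the same line, so the number of lines is
the number of members of `X`. -/
structure IsEquiangularSet {n : ℕ} (α : ℝ) (X : Set (EuclideanSpace ℝ (Fin n))) : Prop where
  angle_nonneg : 0 ≤ α
  angle_lt_one : α < 1
  norm_eq_one : ∀ x ∈ X, ‖x‖ = 1
  inner_eq : ∀ x ∈ X, ∀ y ∈ X, x ≠ y → inner ℝ x y = α ∨ inner ℝ x y = -α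

/-- The lines through the members of `X` and the lines through the members of `Y` are isomorphic:
a linear isometry of the span of `X` onto the span of `Y` carries `X ∪ -X` onto `Y ∪ -Y`.
For sets of unit vectors this says that it carries the one set of lines onto the other. -/
def LinesIsomorphic {m n : ℕ} (X : Set (EuclideanSpace ℝ (Fin m)))
    (Y : Set (EuclideanSpace ℝ (Fin n))) : Prop :=
  ∃ φ : Submodule.span ℝ X ≃ₗᵢ[ℝ] Submodule.span ℝ Y,
    ∀ v : Submodule.span ℝ X,
      ((v : EuclideanSpace ℝ (Fin m)) ∈ X ∨ -(v : EuclideanSpace ℝ (Fin m)) ∈ X) ↔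
        ((φ v : EuclideanSpace ℝ (Fin n)) ∈ Y ∨ -(φ v : EuclideanSpace ℝ (Fin n)) ∈ Y)

/-! ### Pillars and the dimension they can span. -/

section Pillars

variable {E : Type*} [NormedAddCommGroup E] [InnerProductSpace ℝ E]

/-! Close `X` under negation. If no three of these vectors have pairwise inner products `-1/3`,
signs can be chosen so that all inner products are `1/3`; the Gram matrix is then positive definite
and there are at most 8 lines (`encard_le_finrank`).

Otherwise three such vectors, with minus their sum, form a regular tetrahedron, whose edge midpoints
give an orthogonal triple `h`. Every vector is then either `±h 0 ± h 1 ± h 2`, which accounts for at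
most 4 lines, or `±(h i + c)` with `c` orthogonal to `h` (`exists_orthogonal_triple`). The vectors
`c` over one `i` form a pillar: they are pairwise orthogonal or opposite, and meet those of another
pillar in `±1/3` (`isPillars`).

The crux is `exists_finset_span`: two nonempty pillars force all pillars into dimension 4, hence
rank at most `3 + 4 = 7`. In rank 8 only one pillar is therefore nonempty, and it consists, up to
sign, of `8 - 3 = 5` orthogonal vectors. So every line is one of the `4 + 2 * 5 = 14` lines of a
model determined by an orthogonal frame with prescribed lengths (`exists_modelFrame`). This gives
the bound. With 14 lines the whole model is filled, and an isometry matching two frames gives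
uniqueness. Building the frame in dimension 8 gives existence. -/

theorem eq_or_eq_neg_of_inner {x y : E} {q : ℝ} (hx : inner ℝ x x = q) (hy : inner ℝ y y = q)
    (h : inner ℝ x y = q ∨ inner ℝ x y = -q) : x = y ∨ x = -y := by
  have hc := real_inner_comm x y
  rcases h with h | h
  · left
    rw [← sub_eq_zero, ← inner_self_eq_zero (𝕜 := ℝ)]
    simp only [inner_sub_left, inner_sub_right]
    linarith
  · right
    rw [← sub_eq_zero, ← inner_self_eq_zero (𝕜 := ℝ)]
    simp only [inner_sub_left, inner_sub_right, inner_neg_left, inner_neg_right]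
    linarith

/-- The component of `b` orthogonal to an orthogonal family of vectors of squared norm `2 / 3`. -/
noncomputable def frameResidual {k : ℕ} (a : Fin k → E) (b : E) : E :=
  b - ∑ l, (3 / 2 * inner ℝ b (a l)) • a l

theorem inner_frameResidual {k : ℕ} {a : Fin k → E}
    (ha : ∀ l l', inner ℝ (a l) (a l') = if l = l' then 2 / 3 else 0) (b c : E) :
    inner ℝ (frameResidual a b) (frameResidual a c) =
      inner ℝ b c - 3 / 2 * ∑ l, inner ℝ b (a l) * inner ℝ c (a l) := by
  have h : ∀ l, inner ℝ (a l) c = inner ℝ c (a l) := fun l => real_inner_comm _ _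
  simp only [frameResidual, inner_sub_left, inner_sub_right, inner_sum, sum_inner,
    real_inner_smul_left, real_inner_smul_right, ha, h, mul_ite, mul_zero,
    Finset.sum_ite_eq', Finset.mem_univ, if_true, Finset.mul_sum]
  rw [sub_sub, ← Finset.sum_add_distrib]
  congr 1
  refine Finset.sum_congr rfl fun l _ => ?_
  ring

/-- A vector differs from its residual by an element of `W`, so bounding the dimension reduces to
counting residuals up to sign. -/
theorem mem_of_frameResidual_eq {k : ℕ} {a : Fin k → E} {W : Submodule ℝ E} (ha : ∀ l, a l ∈ W)
    {b c : E} (hc : c ∈ W)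
    (h : frameResidual a b = frameResidual a c ∨ frameResidual a b = -frameResidual a c) :
    b ∈ W := by
  have hs : ∀ v : E, ∑ l, (3 / 2 * inner ℝ v (a l)) • a l ∈ W := fun v =>
    W.sum_mem fun l _ => W.smul_mem _ (ha l)
  have hr : frameResidual a c ∈ W := W.sub_mem hc (hs c)
  have hb : frameResidual a b ∈ W := by
    rcases h with h | h <;> rw [h]
    · exact hr
    · exact W.neg_mem hr
  have := W.add_mem hb (hs b)
  rwa [frameResidual, sub_add_cancel] at this

/-- Three families of vectors of squared norm `2 / 3`; members of the same family are orthogonal or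
opposite, members of different families have inner product `1 / 3` or `-1 / 3`. -/
structure IsPillars (S : Fin 3 → Set E) : Prop where
  self : ∀ i, ∀ v ∈ S i, inner ℝ v v = (2 / 3 : ℝ)
  same : ∀ i, ∀ v ∈ S i, ∀ w ∈ S i, v = w ∨ v = -w ∨ inner ℝ v w = (0 : ℝ)
  diff : ∀ i j, i ≠ j → ∀ v ∈ S i, ∀ w ∈ S j,
    inner ℝ v w = (1 / 3 : ℝ) ∨ inner ℝ v w = (-1 / 3 : ℝ)

namespace IsPillars

variable {S : Fin 3 → Set E}

theorem inner_values (hS : IsPillars S) {i : Fin 3} {v w : E} (hv : v ∈ S i) (hw : w ∈ S i) :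
    inner ℝ v w = (2 / 3 : ℝ) ∨ inner ℝ v w = (-2 / 3 : ℝ) ∨ inner ℝ v w = (0 : ℝ) := by
  rcases hS.same i v hv w hw with rfl | h | h
  · exact Or.inl (hS.self i v hv)
  · right; left
    rw [h, inner_neg_left, hS.self i w hw]; norm_num
  · exact Or.inr (Or.inr h)

/-- An orthogonal `k`-frame in one pillar that cannot be enlarged spans that pillar. -/
theorem mem_span_of_maximal (hS : IsPillars S) {i : Fin 3} {k : ℕ} {a : Fin k → E}
    (ha : ∀ l, a l ∈ S i) (hmax : ¬ ∃ v ∈ S i, ∀ l, inner ℝ v (a l) = (0 : ℝ))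
    {W : Submodule ℝ E} (hW : ∀ l, a l ∈ W) {v : E} (hv : v ∈ S i) : v ∈ W := by
  by_contra hvW
  refine hmax ⟨v, hv, fun l => ?_⟩
  rcases hS.same i v hv (a l) (ha l) with h | h | h
  · exact absurd (h ▸ hW l) hvW
  · exact absurd (h ▸ W.neg_mem (hW l)) hvW
  · exact h

/-- A vector of another pillar has residual of squared norm `2/3 - 3/2 * 4/9 = 0`, so it lies in the
span of the frame. A fifth orthogonal vector in pillar `i` would be orthogonal to it, contradicting
`±1/3`. -/
theorem span_of_frame_four (hS : IsPillars S) {i : Fin 3} {a : Fin 4 → E} (ha : ∀ l, a l ∈ S i)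
    (hort : ∀ l l', inner ℝ (a l) (a l') = if l = l' then (2 / 3 : ℝ) else 0)
    {j : Fin 3} (hij : j ≠ i) (hj : (S j).Nonempty)
    {W : Submodule ℝ E} (hW : ∀ l, a l ∈ W) : ∀ k, S k ⊆ W := by
  have hout : ∀ m, m ≠ i → ∀ b ∈ S m, frameResidual a b = frameResidual a 0 := by
    intro m hm b hb
    have h0 : frameResidual a (0 : E) = 0 := by simp [frameResidual]
    rw [h0, ← inner_self_eq_zero (𝕜 := ℝ), inner_frameResidual hort, hS.self m b hb,
      Fin.sum_univ_four]
    have h := fun l => hS.diff m i hm b hb (a l) (ha l)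
    have hsq : ∀ l, inner ℝ b (a l) * inner ℝ b (a l) = (1 / 9 : ℝ) := by
      intro l; rcases h l with h | h <;> rw [h] <;> norm_num
    rw [hsq, hsq, hsq, hsq]; norm_num
  obtain ⟨b, hb⟩ := hj
  have hmax : ¬ ∃ v ∈ S i, ∀ l, inner ℝ v (a l) = (0 : ℝ) := by
    rintro ⟨v, hv, hva⟩
    have h1 := hout j hij b hb
    have h0 : frameResidual a (0 : E) = 0 := by simp [frameResidual]
    have h2 := inner_frameResidual hort b v
    rw [h1, h0, inner_zero_left] at h2
    simp only [hva, mul_zero, Finset.sum_const_zero, sub_zero] at h2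
    rcases hS.diff j i hij b hb v hv with h | h <;> linarith
  intro k v hv
  by_cases hk : k = i
  · subst hk
    exact hS.mem_span_of_maximal ha hmax hW hv
  · exact mem_of_frameResidual_eq hW W.zero_mem (Or.inl (hout k hk v hv))

/-- Residuals outside pillar `i` have squared norm `2/3 - 3/2 * 3/9 = 1/6`, and their inner products
are odd multiples of `1/6`. Cauchy–Schwarz leaves only `±1/6`, so all residuals lie on one line. -/
theorem span_of_frame_three (hS : IsPillars S) {i : Fin 3} {a : Fin 3 → E} (ha : ∀ l, a l ∈ S i)
    (hort : ∀ l l', inner ℝ (a l) (a l') = if l = l' then (2 / 3 : ℝ) else 0)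
    (hmax : ¬ ∃ v ∈ S i, ∀ l, inner ℝ v (a l) = (0 : ℝ))
    {j : Fin 3} (hij : j ≠ i) {b : E} (hb : b ∈ S j)
    {W : Submodule ℝ E} (hW : ∀ l, a l ∈ W) (hbW : b ∈ W) : ∀ k, S k ⊆ W := by
  have hself : ∀ m, m ≠ i → ∀ v ∈ S m, inner ℝ (frameResidual a v) (frameResidual a v) = (1 / 6 : ℝ) := by
    intro m hm v hv
    have h := fun l => hS.diff m i hm v hv (a l) (ha l)
    have hsq : ∀ l, inner ℝ v (a l) * inner ℝ v (a l) = (1 / 9 : ℝ) := by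
      intro l; rcases h l with h | h <;> rw [h] <;> norm_num
    rw [inner_frameResidual hort, hS.self m v hv, Fin.sum_univ_three, hsq, hsq, hsq]; norm_num
  intro k v hv
  by_cases hk : k = i
  · subst hk
    exact hS.mem_span_of_maximal ha hmax hW hv
  refine mem_of_frameResidual_eq hW hbW (eq_or_eq_neg_of_inner (hself k hk v hv) (hself j hij b hb) ?_)
  have hcs := real_inner_mul_inner_self_le (frameResidual a v) (frameResidual a b)
  rw [hself k hk v hv, hself j hij b hb] at hcs
  rw [inner_frameResidual hort, Fin.sum_univ_three] at hcs ⊢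
  have hvals : inner ℝ v b = (2 / 3 : ℝ) ∨ inner ℝ v b = (-2 / 3 : ℝ) ∨ inner ℝ v b = (0 : ℝ) ∨
      inner ℝ v b = (1 / 3 : ℝ) ∨ inner ℝ v b = (-1 / 3 : ℝ) := by
    by_cases hkj : k = j
    · subst hkj
      have := hS.inner_values hv hb
      tauto
    · have := hS.diff k j hkj v hv b hb
      tauto
  have hpm : ∀ l, inner ℝ v (a l) * inner ℝ b (a l) = (1 / 9 : ℝ) ∨
      inner ℝ v (a l) * inner ℝ b (a l) = (-1 / 9 : ℝ) := by
    intro l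
    rcases hS.diff k i hk v hv (a l) (ha l) with h | h <;>
    rcases hS.diff j i hij b hb (a l) (ha l) with h' | h' <;> rw [h, h'] <;> norm_num
  rcases hpm 0 with h0 | h0 <;> rcases hpm 1 with h1 | h1 <;> rcases hpm 2 with h2 | h2 <;>
    rw [h0, h1, h2] at hcs ⊢ <;> rcases hvals with h | h | h | h | h <;> rw [h] at hcs ⊢ <;>
    first | (left; norm_num; done) | (right; norm_num; done) | norm_num at hcs

/-- Residuals now have squared norm `1/3`, and Cauchy–Schwarz leaves the inner products `±1/3`
(equal or opposite residuals) and `0`. In the orthogonal case, the product of the two inner products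
with the frame changes sign within a pillar and is the same across pillars. -/
theorem dichotomy_of_frame_two (hS : IsPillars S) {i : Fin 3} {a : Fin 2 → E}
    (ha : ∀ l, a l ∈ S i)
    (hort : ∀ l l', inner ℝ (a l) (a l') = if l = l' then (2 / 3 : ℝ) else 0)
    {j k : Fin 3} (hj : j ≠ i) (hk : k ≠ i) {v w : E} (hv : v ∈ S j) (hw : w ∈ S k) :
    (frameResidual a v = frameResidual a w ∨ frameResidual a v = -frameResidual a w) ∨
      ((j = k → inner ℝ v (a 0) * inner ℝ v (a 1) = -(inner ℝ w (a 0) * inner ℝ w (a 1) : ℝ)) ∧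
       (j ≠ k → inner ℝ v (a 0) * inner ℝ v (a 1) = (inner ℝ w (a 0) * inner ℝ w (a 1) : ℝ))) := by
  have hself : ∀ m, m ≠ i → ∀ v ∈ S m,
      inner ℝ (frameResidual a v) (frameResidual a v) = (1 / 3 : ℝ) := by
    intro m hm v hv
    have h := fun l => hS.diff m i hm v hv (a l) (ha l)
    have hsq : ∀ l, inner ℝ v (a l) * inner ℝ v (a l) = (1 / 9 : ℝ) := by
      intro l; rcases h l with h | h <;> rw [h] <;> norm_num
    rw [inner_frameResidual hort, hS.self m v hv, Fin.sum_univ_two, hsq, hsq]; norm_num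
  rw [or_iff_not_imp_left]
  intro hne
  have hne' := fun h => hne (eq_or_eq_neg_of_inner (hself j hj v hv) (hself k hk w hw) h)
  have hcs := real_inner_mul_inner_self_le (frameResidual a v) (frameResidual a w)
  rw [hself j hj v hv, hself k hk w hw] at hcs
  rw [inner_frameResidual hort, Fin.sum_univ_two] at hcs hne'
  have key : ∀ x : ℝ, (j = k → x = 2 / 3 ∨ x = -2 / 3 ∨ x = 0) →
      (j ≠ k → x = 1 / 3 ∨ x = -1 / 3) → inner ℝ v w = x →
      ((j = k → inner ℝ v (a 0) * inner ℝ v (a 1) = -(inner ℝ w (a 0) * inner ℝ w (a 1) : ℝ)) ∧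
       (j ≠ k → inner ℝ v (a 0) * inner ℝ v (a 1) =
        (inner ℝ w (a 0) * inner ℝ w (a 1) : ℝ))) := by
    intro x hx hx' hvw
    rw [hvw] at hcs hne'
    constructor
    · intro hjk
      rcases hS.diff j i hj v hv (a 0) (ha 0) with h0 | h0 <;>
      rcases hS.diff j i hj v hv (a 1) (ha 1) with h1 | h1 <;>
      rcases hS.diff k i hk w hw (a 0) (ha 0) with h2 | h2 <;>
      rcases hS.diff k i hk w hw (a 1) (ha 1) with h3 | h3 <;>
      rw [h0, h1, h2, h3] at hcs hne' ⊢ <;> rcases hx hjk with h | h | h <;> subst h <;>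
      first | (norm_num; done) | (norm_num at hcs; done) | norm_num at hne'
    · intro hjk
      rcases hS.diff j i hj v hv (a 0) (ha 0) with h0 | h0 <;>
      rcases hS.diff j i hj v hv (a 1) (ha 1) with h1 | h1 <;>
      rcases hS.diff k i hk w hw (a 0) (ha 0) with h2 | h2 <;>
      rcases hS.diff k i hk w hw (a 1) (ha 1) with h3 | h3 <;>
      rw [h0, h1, h2, h3] at hcs hne' ⊢ <;> rcases hx' hjk with h | h <;> subst h <;>
      first | (norm_num; done) | (norm_num at hcs; done) | norm_num at hne'
  refine key _ (fun hjk => ?_) (fun hjk => hS.diff j k hjk v hv w hw) rfl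
  subst hjk
  exact hS.inner_values hv hw

/-- The residuals occupy at most two lines: that of `b` and, if there is a second one, that of `c`.
-/
theorem span_of_frame_two (hS : IsPillars S) {i : Fin 3} {a : Fin 2 → E}
    (ha : ∀ l, a l ∈ S i)
    (hort : ∀ l l', inner ℝ (a l) (a l') = if l = l' then (2 / 3 : ℝ) else 0)
    (hmax : ¬ ∃ v ∈ S i, ∀ l, inner ℝ v (a l) = (0 : ℝ))
    {j : Fin 3} (hij : j ≠ i) {b : E} (hb : b ∈ S j) :
    ∃ c : E, ∀ W : Submodule ℝ E, (∀ l, a l ∈ W) → b ∈ W → c ∈ W → ∀ k, S k ⊆ W := by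
  by_cases hall : ∀ k, k ≠ i → ∀ v ∈ S k,
      frameResidual a v = frameResidual a b ∨ frameResidual a v = -frameResidual a b
  -- There is no second residual line here, so `c` is a dummy.
  · refine ⟨0, fun W hW hbW _ k v hv => ?_⟩
    by_cases hk : k = i
    · subst hk
      exact hS.mem_span_of_maximal ha hmax hW hv
    · exact mem_of_frameResidual_eq hW hbW (hall k hk v hv)
  push Not at hall
  obtain ⟨m, hm, c, hc, hcb⟩ := hall
  refine ⟨c, fun W hW hbW hcW k v hv => ?_⟩
  by_cases hk : k = i
  · subst hk
    exact hS.mem_span_of_maximal ha hmax hW hv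
  rcases hS.dichotomy_of_frame_two ha hort hk hij hv hb with h | h1
  · exact mem_of_frameResidual_eq hW hbW h
  rcases hS.dichotomy_of_frame_two ha hort hk hm hv hc with h | h2
  · exact mem_of_frameResidual_eq hW hcW h
  rcases hS.dichotomy_of_frame_two ha hort hm hij hc hb with h | h3
  · exact absurd h (not_or.mpr hcb)
  exfalso
  have hne : ∀ {l : Fin 3} {w : E}, l ≠ i → w ∈ S l →
      inner ℝ w (a 0) * inner ℝ w (a 1) ≠ (0 : ℝ) := by
    intro l w hl hw
    rcases hS.diff l i hl w hw (a 0) (ha 0) with h | h <;>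
    rcases hS.diff l i hl w hw (a 1) (ha 1) with h' | h' <;> rw [h, h'] <;> norm_num
  have nv := hne hk hv
  have split : ∀ {p : Prop} {r t : ℝ}, (p → r = -t) ∧ (¬ p → r = t) →
      (p ∧ r = -t) ∨ (¬ p ∧ r = t) := fun {p _ _} h =>
    (em p).imp (fun hp => ⟨hp, h.1 hp⟩) (fun hp => ⟨hp, h.2 hp⟩)
  -- Parity: `v`, `b`, `c` come from only two pillars, so one or three of the pairs share a pillar.
  -- An odd number of sign changes around the triangle makes a nonzero product its own negative.
  rcases split h1 with ⟨e1, f1⟩ | ⟨e1, f1⟩ <;> rcases split h2 with ⟨e2, f2⟩ | ⟨e2, f2⟩ <;>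
    rcases split h3 with ⟨e3, f3⟩ | ⟨e3, f3⟩ <;>
  first
    | omega
    | exact nv (by linarith)

/-- If two pillars are nonempty, then all pillars lie in a subspace of dimension at most four. -/
theorem exists_finset_span [DecidableEq E] (hS : IsPillars S) {i j : Fin 3} (hij : i ≠ j)
    (hi : (S i).Nonempty) (hj : (S j).Nonempty) :
    ∃ T : Finset E, T.card ≤ 4 ∧ ∀ k, S k ⊆ Submodule.span ℝ (T : Set E) := by
  -- An orthogonal frame in one pillar is extended until it is maximal or has four members; sizes 4,
  -- 3, 2 give dimensions `4 + 0`, `3 + 1`, `2 + 2`. Without an orthogonal pair each pillar is at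
  -- most one line.
  by_cases h2 : ∃ m, ∃ v ∈ S m, ∃ w ∈ S m, inner ℝ v w = (0 : ℝ)
  · obtain ⟨m, v, hv, w, hw, hvw⟩ := h2
    have hwv : inner ℝ w v = (0 : ℝ) := by rw [real_inner_comm, hvw]
    have hv2 := hS.self m v hv
    have hw2 := hS.self m w hw
    obtain ⟨l, hl, hlS⟩ : ∃ l, l ≠ m ∧ (S l).Nonempty := by
      by_cases h : i = m
      · exact ⟨j, fun h' => hij (h.trans h'.symm), hj⟩
      · exact ⟨i, h, hi⟩
    obtain ⟨b, hb⟩ := hlS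
    by_cases h3 : ∃ x ∈ S m, ∀ l, inner ℝ x (![v, w] l) = (0 : ℝ)
    · obtain ⟨x, hx, hxa⟩ := h3
      have hxv : inner ℝ x v = (0 : ℝ) := hxa 0
      have hxw : inner ℝ x w = (0 : ℝ) := hxa 1
      have hvx : inner ℝ v x = (0 : ℝ) := by rw [real_inner_comm, hxv]
      have hwx : inner ℝ w x = (0 : ℝ) := by rw [real_inner_comm, hxw]
      have hx2 := hS.self m x hx
      by_cases h4 : ∃ y ∈ S m, ∀ l, inner ℝ y (![v, w, x] l) = (0 : ℝ)
      · obtain ⟨y, hy, hya⟩ := h4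
        have hyv : inner ℝ y v = (0 : ℝ) := hya 0
        have hyw : inner ℝ y w = (0 : ℝ) := hya 1
        have hyx : inner ℝ y x = (0 : ℝ) := hya 2
        have hvy : inner ℝ v y = (0 : ℝ) := by rw [real_inner_comm, hyv]
        have hwy : inner ℝ w y = (0 : ℝ) := by rw [real_inner_comm, hyw]
        have hxy : inner ℝ x y = (0 : ℝ) := by rw [real_inner_comm, hyx]
        have hy2 := hS.self m y hy
        refine ⟨{v, w, x, y}, Finset.card_le_four, ?_⟩
        refine hS.span_of_frame_four (i := m) (a := ![v, w, x, y]) ?_ ?_ hl ⟨b, hb⟩ ?_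
        · intro l; fin_cases l <;> assumption
        · intro l l'; fin_cases l <;> fin_cases l' <;>
          simp [-inner_self_eq_norm_sq_to_K, *]
        · intro l; apply Submodule.subset_span; fin_cases l <;> simp
      · refine ⟨{v, w, x, b}, Finset.card_le_four, ?_⟩
        refine hS.span_of_frame_three (i := m) (a := ![v, w, x]) ?_ ?_ h4 hl hb ?_ ?_
        · intro l; fin_cases l <;> assumption
        · intro l l'; fin_cases l <;> fin_cases l' <;>
          simp [-inner_self_eq_norm_sq_to_K, *]
        · intro l; apply Submodule.subset_span; fin_cases l <;> simp
        · apply Submodule.subset_span; simp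
    · obtain ⟨c, hc⟩ := hS.span_of_frame_two (i := m) (a := ![v, w])
        (by intro l; fin_cases l <;> assumption)
        (by intro l l'; fin_cases l <;> fin_cases l' <;>
          simp [-inner_self_eq_norm_sq_to_K, *]) h3 hl hb
      refine ⟨{v, w, b, c}, Finset.card_le_four, hc _ ?_ ?_ ?_⟩
      · intro l; apply Submodule.subset_span; fin_cases l <;> simp
      · apply Submodule.subset_span; simp
      · apply Submodule.subset_span; simp
  · have h1 : ∀ m, ∃ u : E, ∀ v ∈ S m, v = u ∨ v = -u := by
      intro m
      rcases (S m).eq_empty_or_nonempty with h | ⟨u, hu⟩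
      · exact ⟨0, by simp [h]⟩
      · refine ⟨u, fun v hv => ?_⟩
        rcases hS.same m v hv u hu with h | h | h
        · exact Or.inl h
        · exact Or.inr h
        · exact absurd ⟨m, v, hv, u, hu, h⟩ h2
    choose u hu using h1
    refine ⟨{u 0, u 1, u 2}, Finset.card_le_three.trans (by norm_num), fun k v hv => ?_⟩
    have hk : u k ∈ Submodule.span ℝ ((({u 0, u 1, u 2} : Finset E)) : Set E) := by
      apply Submodule.subset_span; fin_cases k <;> simp
    rcases hu k v hv with h | h <;> rw [h]
    · exact hk
    · exact Submodule.neg_mem _ hk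

end IsPillars

end Pillars

/-! ### Decomposition of a line system along a tetrahedron. -/

section LineSystems

variable {E : Type*} [NormedAddCommGroup E] [InnerProductSpace ℝ E]

/-- A symmetric set of unit vectors in which any two that are neither equal nor opposite have inner
product `1 / 3` or `-1 / 3`. -/
structure IsLineSystem (Z : Set E) : Prop where
  neg_mem : ∀ z ∈ Z, -z ∈ Z
  self : ∀ z ∈ Z, inner ℝ z z = (1 : ℝ)
  inner_eq : ∀ z ∈ Z, ∀ w ∈ Z,
    z = w ∨ z = -w ∨ inner ℝ z w = (1 / 3 : ℝ) ∨ inner ℝ z w = (-1 / 3 : ℝ)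

/-- The orthogonal vectors pointing at the midpoints of three edges at a vertex of the tetrahedron
`x`, `y`, `t`, `-(x + y + t)`. -/
noncomputable def tetraFrame (x y t : E) : Fin 3 → E :=
  ![(1 / 2 : ℝ) • (x + y), (1 / 2 : ℝ) • (x + t), (1 / 2 : ℝ) • (y + t)]

/-- The signs of the inner products of `z` with `x`, `y`, `t` decide the case: three equal signs
make `z` equal to `±(x + y + t)`, while mixed signs make `z` orthogonal to two of the `h j`, with
inner product `±1/3` with the third. -/
theorem IsLineSystem.exists_orthogonal_triple {Z : Set E} (hZ : IsLineSystem Z) {x y t : E}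
    (hx : x ∈ Z) (hy : y ∈ Z) (ht : t ∈ Z) (hxy : inner ℝ x y = (-1 / 3 : ℝ))
    (hxt : inner ℝ x t = (-1 / 3 : ℝ)) (hyt : inner ℝ y t = (-1 / 3 : ℝ)) :
    ∃ h : Fin 3 → E, (∀ i j, inner ℝ (h i) (h j) = if i = j then (1 / 3 : ℝ) else 0) ∧
      (∀ i, h i ∈ Submodule.span ℝ Z) ∧
      ∀ z ∈ Z, (∃ ε : Fin 3 → ℝ, (∀ i, ε i = 1 ∨ ε i = -1) ∧ z = ∑ i, ε i • h i) ∨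
        ∃ i c, (z = h i + c ∨ z = -(h i + c)) ∧ ∀ j, inner ℝ c (h j) = (0 : ℝ) := by
  have hyx := (real_inner_comm x y).trans hxy
  have htx := (real_inner_comm x t).trans hxt
  have hty := (real_inner_comm y t).trans hyt
  have hxx := hZ.self x hx
  have hyy := hZ.self y hy
  have htt := hZ.self t ht
  have hort : ∀ i j, inner ℝ (tetraFrame x y t i) (tetraFrame x y t j) =
      if i = j then (1 / 3 : ℝ) else 0 := by
    intro i j
    fin_cases i <;> fin_cases j <;>
      simp [tetraFrame, -inner_self_eq_norm_sq_to_K, inner_add_left, inner_add_right,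
        real_inner_smul_left, real_inner_smul_right, hxy, hxt, hyt, hyx, htx, hty, hxx, hyy, htt] <;> norm_num
  refine ⟨tetraFrame x y t, hort, ?_, ?_⟩
  · have sx := Submodule.subset_span (R := ℝ) hx
    have sy := Submodule.subset_span (R := ℝ) hy
    have st := Submodule.subset_span (R := ℝ) ht
    intro i
    fin_cases i
    · exact Submodule.smul_mem _ _ (Submodule.add_mem _ sx sy)
    · exact Submodule.smul_mem _ _ (Submodule.add_mem _ sx st)
    · exact Submodule.smul_mem _ _ (Submodule.add_mem _ sy st)
  intro z hz
  have hzz := hZ.self z hz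
  have base : ∀ a b c : ℝ, (a = 1 ∨ a = -1) → (b = 1 ∨ b = -1) → (c = 1 ∨ c = -1) →
      z = a • (1 / 2 : ℝ) • (x + y) + b • (1 / 2 : ℝ) • (x + t) + c • (1 / 2 : ℝ) • (y + t) →
      ∃ ε : Fin 3 → ℝ, (∀ i, ε i = 1 ∨ ε i = -1) ∧ z = ∑ i, ε i •
        tetraFrame x y t i := by
    intro a b c ha hb hc h
    refine ⟨![a, b, c], ?_, ?_⟩
    · intro i; fin_cases i <;> assumption
    · rw [h, Fin.sum_univ_three]; rfl
  rcases hZ.inner_eq z hz x hx with h | h | hzx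
  · left; exact base 1 1 (-1) (by norm_num) (by norm_num) (by norm_num) (by rw [h]; module)
  · left; exact base (-1) (-1) 1 (by norm_num) (by norm_num) (by norm_num) (by rw [h]; module)
  rcases hZ.inner_eq z hz y hy with h | h | hzy
  · left; exact base 1 (-1) 1 (by norm_num) (by norm_num) (by norm_num) (by rw [h]; module)
  · left; exact base (-1) 1 (-1) (by norm_num) (by norm_num) (by norm_num) (by rw [h]; module)
  rcases hZ.inner_eq z hz t ht with h | h | hzt
  · left; exact base (-1) 1 1 (by norm_num) (by norm_num) (by norm_num) (by rw [h]; module)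
  · left; exact base 1 (-1) (-1) (by norm_num) (by norm_num) (by norm_num) (by rw [h]; module)
  have hxz := real_inner_comm z x
  have hyz := real_inner_comm z y
  have htz := real_inner_comm z t
  have side : ∀ i : Fin 3, ∀ s : ℝ, (s = 1 ∨ s = -1) →
      (∀ j, inner ℝ z (tetraFrame x y t j) = if i = j then s / 3 else 0) →
      ∃ i c, (z = tetraFrame x y t i + c ∨
        z = -(tetraFrame x y t i + c)) ∧
        ∀ j, inner ℝ c (tetraFrame x y t j) = (0 : ℝ) := by
    intro i s hs hzh
    refine ⟨i, s • z - tetraFrame x y t i, ?_, fun j => ?_⟩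
    · rcases hs with rfl | rfl
      · left; module
      · right; module
    · rw [inner_sub_left, real_inner_smul_left, hzh, hort]
      rcases hs with rfl | rfl <;> split_ifs <;> norm_num
  rcases hzx with hzx | hzx <;> rcases hzy with hzy | hzy <;> rcases hzt with hzt | hzt <;>
    rw [hzx] at hxz <;> rw [hzy] at hyz <;> rw [hzt] at htz
  · left
    refine base 1 1 1 (by norm_num) (by norm_num) (by norm_num) ?_
    -- The right side is `x + y + t`, a unit vector whose inner product with `z` is `1`.
    rw [← sub_eq_zero, ← inner_self_eq_zero (𝕜 := ℝ)]
    simp only [inner_add_left, inner_add_right, inner_sub_left, inner_sub_right,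
      real_inner_smul_left, real_inner_smul_right, hxy, hxt, hyt, hyx, htx, hty, hxx, hyy, htt,
      hzx, hzy, hzt, hxz, hyz, htz, hzz]
    norm_num
  · right
    refine side 0 1 (by norm_num) fun j => ?_
    fin_cases j <;>
      simp [tetraFrame, inner_add_right, real_inner_smul_right, hzx, hzy, hzt] <;> norm_num
  · right
    refine side 1 1 (by norm_num) fun j => ?_
    fin_cases j <;>
      simp [tetraFrame, inner_add_right, real_inner_smul_right, hzx, hzy, hzt] <;> norm_num
  · right
    refine side 2 (-1) (by norm_num) fun j => ?_
    fin_cases j <;>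
      simp [tetraFrame, inner_add_right, real_inner_smul_right, hzx, hzy, hzt] <;> norm_num
  · right
    refine side 2 1 (by norm_num) fun j => ?_
    fin_cases j <;>
      simp [tetraFrame, inner_add_right, real_inner_smul_right, hzx, hzy, hzt] <;> norm_num
  · right
    refine side 1 (-1) (by norm_num) fun j => ?_
    fin_cases j <;>
      simp [tetraFrame, inner_add_right, real_inner_smul_right, hzx, hzy, hzt] <;> norm_num
  · right
    refine side 0 (-1) (by norm_num) fun j => ?_
    fin_cases j <;>
      simp [tetraFrame, inner_add_right, real_inner_smul_right, hzx, hzy, hzt] <;> norm_num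
  · left
    refine base (-1) (-1) (-1) (by norm_num) (by norm_num) (by norm_num) ?_
    rw [← sub_eq_zero, ← inner_self_eq_zero (𝕜 := ℝ)]
    simp only [inner_add_left, inner_add_right, inner_sub_left, inner_sub_right,
      real_inner_smul_left, real_inner_smul_right, hxy, hxt, hyt, hyx, htx, hty, hxx, hyy, htt,
      hzx, hzy, hzt, hxz, hyz, htz, hzz]
    norm_num

/-- The components, orthogonal to `h`, of the members of `Z` above `h i`. -/
def pillar (Z : Set E) (h : Fin 3 → E) (i : Fin 3) : Set E :=
  {c | h i + c ∈ Z ∧ ∀ j, inner ℝ c (h j) = (0 : ℝ)}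

/-- Passing from `h i + c`, `h j + c'` to `c`, `c'` subtracts `1/3` from the inner product when `i =
j` and nothing otherwise; thus `1`, `1/3`, `-1/3` become `2/3`, `0`, `-2/3` within a pillar. -/
theorem IsLineSystem.isPillars {Z : Set E} (hZ : IsLineSystem Z) {h : Fin 3 → E}
    (hh : ∀ i j, inner ℝ (h i) (h j) = if i = j then (1 / 3 : ℝ) else 0) :
    IsPillars (pillar Z h) := by
  have hin : ∀ i j c c', c ∈ pillar Z h i → c' ∈ pillar Z h j →
      inner ℝ (h i + c) (h j + c') = (if i = j then (1 / 3 : ℝ) else 0) + inner ℝ c c' := by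
    intro i j c c' hc hc'
    have := (real_inner_comm c' (h i)).trans (hc'.2 i)
    have h2 := real_inner_comm (h i) c'
    rw [inner_add_left, inner_add_right, inner_add_right, hh, hc.2 j]
    linarith [hc'.2 i]
  have hih : ∀ i j c, c ∈ pillar Z h i →
      inner ℝ (h i + c) (h j) = if i = j then (1 / 3 : ℝ) else 0 := by
    intro i j c hc
    rw [inner_add_left, hh, hc.2 j, add_zero]
  have hneg : ∀ i j c c', c ∈ pillar Z h i → c' ∈ pillar Z h j → h i + c ≠ -(h j + c') := by
    intro i j c c' hc hc' heq
    have h1 := hih i i c hc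
    have h2 := hih j i c' hc'
    rw [heq, inner_neg_left, h2, if_pos rfl] at h1
    split_ifs at h1 <;> norm_num at h1
  have hself : ∀ i, ∀ c ∈ pillar Z h i, inner ℝ c c = (2 / 3 : ℝ) := by
    intro i c hc
    have := hin i i c c hc hc
    rw [hZ.self _ hc.1, if_pos rfl] at this
    linarith
  refine ⟨hself, ?_, ?_⟩
  · intro i c hc c' hc'
    rcases hZ.inner_eq _ hc.1 _ hc'.1 with h1 | h1 | h1 | h1
    · exact Or.inl (add_left_cancel h1)
    · exact absurd h1 (hneg i i c c' hc hc')
    · right; right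
      rw [hin i i c c' hc hc', if_pos rfl] at h1
      linarith
    · right; left
      rw [hin i i c c' hc hc', if_pos rfl] at h1
      have h2 : inner ℝ c c' = -(2 / 3 : ℝ) := by linarith
      refine (eq_or_eq_neg_of_inner (hself i c hc) (hself i c' hc') (Or.inr h2)).resolve_left ?_
      rintro rfl
      rw [hself i c hc] at h2
      norm_num at h2
  · intro i j hij c hc c' hc'
    rcases hZ.inner_eq _ hc.1 _ hc'.1 with h1 | h1 | h1 | h1
    · have h2 := hih i i c hc
      rw [h1, hih j i c' hc', if_neg hij.symm, if_pos rfl] at h2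
      norm_num at h2
    · exact absurd h1 (hneg i j c c' hc hc')
    · left
      rwa [hin i j c c' hc hc', if_neg hij, zero_add] at h1
    · right
      rwa [hin i j c c' hc hc', if_neg hij, zero_add] at h1

end LineSystems

/-! ### The model of fourteen lines, and why rank 8 forces it. -/

section Model

variable {E : Type*} [NormedAddCommGroup E] [InnerProductSpace ℝ E]

/-- `u` is an orthogonal family with squared norms `1 / 3` (three times) and `2 / 3` (five times). -/
def IsModelFrame (u : Fin 3 ⊕ Fin 5 → E) : Prop :=
  ∀ k l, inner ℝ (u k) (u l) =
    if k = l then (Sum.elim (fun _ => 1 / 3) (fun _ => 2 / 3) k : ℝ) else 0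

/-- The coordinates of the fourteen lines of the model: four along the diagonals of a cube, and five
pairs in a pillar. -/
def modelCoeff : Option (Fin 3) ⊕ Fin 5 × Bool → Fin 3 ⊕ Fin 5 → ℤ
  | Sum.inl o, Sum.inl k => if o = some k then -1 else 1
  | Sum.inl _, Sum.inr _ => 0
  | Sum.inr _, Sum.inl k => if k = 0 then 1 else 0
  | Sum.inr p, Sum.inr l => if p.1 = l then (if p.2 then 1 else -1) else 0

/-- The vector of the model with index `a`, with respect to the frame `u`. -/
noncomputable def modelVec (u : Fin 3 ⊕ Fin 5 → E) (a : Option (Fin 3) ⊕ Fin 5 × Bool) : E :=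
  ∑ k, (modelCoeff a k : ℝ) • u k

/-- The weights `1` and `2` are three times the squared lengths in a model frame, so `s` is three
times the inner product and the check is finite integer arithmetic. -/
theorem modelCoeff_gram (a b : Option (Fin 3) ⊕ Fin 5 × Bool) :
    let s := ∑ k, modelCoeff a k * modelCoeff b k * Sum.elim (fun _ => 1) (fun _ => 2) k
    if a = b then s = 3 else s = 1 ∨ s = -1 := by
  revert a b
  decide

theorem IsModelFrame.inner_modelVec {u : Fin 3 ⊕ Fin 5 → E} (hu : IsModelFrame u)
    (a b : Option (Fin 3) ⊕ Fin 5 × Bool) :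
    inner ℝ (modelVec u a) (modelVec u b) =
      ((∑ k, modelCoeff a k * modelCoeff b k * Sum.elim (fun _ => 1) (fun _ => 2) k : ℤ) : ℝ) / 3 := by
  have hu' := hu
  unfold IsModelFrame at hu'
  simp only [modelVec, inner_sum, sum_inner, real_inner_smul_left, real_inner_smul_right, hu',
    mul_ite, mul_zero, Finset.sum_ite_eq', Finset.mem_univ, if_true]
  push_cast
  rw [Finset.sum_div]
  refine Finset.sum_congr rfl fun k _ => ?_
  rcases k with k | k <;> simp <;> ring

theorem IsModelFrame.modelVec_self {u : Fin 3 ⊕ Fin 5 → E} (hu : IsModelFrame u)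
    (a : Option (Fin 3) ⊕ Fin 5 × Bool) : inner ℝ (modelVec u a) (modelVec u a) = (1 : ℝ) := by
  have h := modelCoeff_gram a a
  simp only [if_true] at h
  rw [hu.inner_modelVec, h]; norm_num

theorem IsModelFrame.modelVec_inner_of_ne {u : Fin 3 ⊕ Fin 5 → E} (hu : IsModelFrame u)
    {a b : Option (Fin 3) ⊕ Fin 5 × Bool} (hab : a ≠ b) :
    inner ℝ (modelVec u a) (modelVec u b) = (1 / 3 : ℝ) ∨
      inner ℝ (modelVec u a) (modelVec u b) = -(1 / 3 : ℝ) := by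
  have h := modelCoeff_gram a b
  simp only [if_neg hab] at h
  rw [hu.inner_modelVec]
  rcases h with h | h <;> rw [h] <;> norm_num

theorem modelVec_inl (u : Fin 3 ⊕ Fin 5 → E) (o : Option (Fin 3)) :
    modelVec u (Sum.inl o) = ∑ k, (if o = some k then (-1 : ℝ) else 1) • u (Sum.inl k) := by
  simp [modelVec, modelCoeff, Fintype.sum_sum_type]

theorem modelVec_inr (u : Fin 3 ⊕ Fin 5 → E) (l : Fin 5) (s : Bool) :
    modelVec u (Sum.inr (l, s)) = u (Sum.inl 0) + (if s then (1 : ℝ) else -1) • u (Sum.inr l) := by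
  simp [modelVec, modelCoeff, Fintype.sum_sum_type]

/-- Up to a global sign, at most one of three signs is negative; its position, if any, is `o`. -/
theorem exists_modelVec_of_signs (u : Fin 3 ⊕ Fin 5 → E) {ε : Fin 3 → ℝ}
    (hε : ∀ i, ε i = 1 ∨ ε i = -1) :
    ∃ o, ∑ i, ε i • u (Sum.inl i) = modelVec u (Sum.inl o) ∨
      ∑ i, ε i • u (Sum.inl i) = -modelVec u (Sum.inl o) := by
  simp only [modelVec_inl, Fin.sum_univ_three]
  rcases hε 0 with h0 | h0 <;> rcases hε 1 with h1 | h1 <;> rcases hε 2 with h2 | h2 <;>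
    rw [h0, h1, h2]
  · exact ⟨none, Or.inl (by simp)⟩
  · exact ⟨some 2, Or.inl (by simp)⟩
  · exact ⟨some 1, Or.inl (by simp)⟩
  · exact ⟨some 0, Or.inr (by simp; abel)⟩
  · exact ⟨some 0, Or.inl (by simp)⟩
  · exact ⟨some 1, Or.inr (by simp; abel)⟩
  · exact ⟨some 2, Or.inr (by simp; abel)⟩
  · exact ⟨none, Or.inr (by simp; abel)⟩

theorem IsLineSystem.exists_pillar_eq_empty [FiniteDimensional ℝ E] {Z : Set E}
    (hZ : IsLineSystem Z) (hr : 7 < Module.finrank ℝ (Submodule.span ℝ Z)) {h : Fin 3 → E}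
    (hh : ∀ i j, inner ℝ (h i) (h j) = if i = j then (1 / 3 : ℝ) else 0)
    (hcov : ∀ z ∈ Z, (∃ ε : Fin 3 → ℝ, (∀ i, ε i = 1 ∨ ε i = -1) ∧ z = ∑ i, ε i • h i) ∨
      ∃ i, ∃ c ∈ pillar Z h i, z = h i + c ∨ z = -(h i + c)) :
    ∃ i, ∀ j ≠ i, pillar Z h j = ∅ := by
  classical
  by_contra hne
  push Not at hne
  obtain ⟨i, -, hi⟩ := hne 0
  obtain ⟨j, hji, hj⟩ := hne i
  obtain ⟨T, hT, hS⟩ := (hZ.isPillars hh).exists_finset_span hji hj hi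
  have hle : Submodule.span ℝ Z ≤ Submodule.span ℝ ((Finset.univ.image h ∪ T : Finset E) : Set E) := by
    have hmem : ∀ i, h i ∈ Submodule.span ℝ ((Finset.univ.image h ∪ T : Finset E) : Set E) := by
      intro i; apply Submodule.subset_span; simp
    have hc : ∀ i, ∀ c ∈ pillar Z h i,
        c ∈ Submodule.span ℝ ((Finset.univ.image h ∪ T : Finset E) : Set E) := fun i c hc =>
      Submodule.span_mono (by simp) (hS i hc)
    rw [Submodule.span_le]
    intro z hz
    rcases hcov z hz with ⟨ε, -, rfl⟩ | ⟨i, c, hci, rfl | rfl⟩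
    · exact Submodule.sum_mem _ fun i _ => Submodule.smul_mem _ _ (hmem i)
    · exact Submodule.add_mem _ (hmem i) (hc i c hci)
    · exact Submodule.neg_mem _ (Submodule.add_mem _ (hmem i) (hc i c hci))
  have h1 := Submodule.finrank_mono hle
  have h2 := finrank_span_finset_le_card (R := ℝ) (Finset.univ.image h ∪ T)
  rw [Set.finrank] at h2
  have h3 := Finset.card_union_le (Finset.univ.image h) T
  have h4 : (Finset.univ.image h).card ≤ 3 := Finset.card_image_le
  omega

/-- The members of one pillar are, up to sign, the members of an orthogonal set. -/
theorem IsPillars.exists_orthogonal_subset [DecidableEq E] {S : Fin 3 → Set E} (hS : IsPillars S) (i : Fin 3) :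
    ∃ b ⊆ S i, (∀ v w : b, inner ℝ (v : E) (w : E) = if v = w then (2 / 3 : ℝ) else 0) ∧
      ∀ c ∈ S i, ∃ v ∈ b, c = v ∨ c = -v := by
  -- Linear independence excludes opposite pairs, leaving orthogonal ones; a member of the pillar
  -- that is not `±` an element of `b` would be orthogonal to its own span.
  obtain ⟨b, hb, hspan, hli⟩ := exists_linearIndependent ℝ (S i)
  refine ⟨b, hb, fun v w => ?_, fun c hc => ?_⟩
  · split_ifs with h
    · rw [h]; exact hS.self i w (hb w.2)
    · rcases hS.same i v (hb v.2) w (hb w.2) with h1 | h1 | h1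
      · exact absurd (Subtype.ext h1) h
      · exfalso
        have h2 := linearIndependent_iff'.mp hli {v, w} (fun _ => 1)
          (by rw [Finset.sum_pair h]; simp [h1]) v (by simp)
        exact one_ne_zero h2
      · exact h1
  · by_contra hne
    push Not at hne
    have horth : ∀ v ∈ b, inner ℝ c v = (0 : ℝ) := by
      intro v hv
      rcases hS.same i c hc v (hb hv) with h1 | h1 | h1
      · exact absurd h1 (hne v hv).1
      · exact absurd h1 (hne v hv).2
      · exact h1
    have hcspan : c ∈ Submodule.span ℝ b := hspan ▸ Submodule.subset_span hc
    have h0 : inner ℝ c c = (0 : ℝ) := by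
      refine Submodule.span_induction (p := fun x _ => inner ℝ c x = (0 : ℝ)) horth
        (inner_zero_right c) ?_ ?_ hcspan
      · intro x y _ _ hx hy; rw [inner_add_right, hx, hy, add_zero]
      · intro r x _ hx; rw [real_inner_smul_right, hx, mul_zero]
    rw [hS.self i c hc] at h0
    norm_num at h0

theorem IsLineSystem.exists_modelFrame [FiniteDimensional ℝ E] {Z : Set E} (hZ : IsLineSystem Z)
    (hr : Module.finrank ℝ (Submodule.span ℝ Z) = 8) {x y t : E}
    (hx : x ∈ Z) (hy : y ∈ Z) (ht : t ∈ Z) (hxy : inner ℝ x y = (-1 / 3 : ℝ))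
    (hxt : inner ℝ x t = (-1 / 3 : ℝ)) (hyt : inner ℝ y t = (-1 / 3 : ℝ)) :
    ∃ u : Fin 3 ⊕ Fin 5 → E, IsModelFrame u ∧ (∀ k, u k ∈ Submodule.span ℝ Z) ∧
      ∀ z ∈ Z, ∃ a, z = modelVec u a ∨ z = -modelVec u a := by
  classical
  obtain ⟨h, hh, hspan, hcov'⟩ := hZ.exists_orthogonal_triple hx hy ht hxy hxt hyt
  have hcov : ∀ z ∈ Z, (∃ ε : Fin 3 → ℝ, (∀ i, ε i = 1 ∨ ε i = -1) ∧ z = ∑ i, ε i • h i) ∨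
      ∃ i, ∃ c ∈ pillar Z h i, z = h i + c ∨ z = -(h i + c) := by
    intro z hz
    rcases hcov' z hz with h1 | ⟨i, c, h1, h2⟩
    · exact Or.inl h1
    · refine Or.inr ⟨i, c, ⟨?_, h2⟩, h1⟩
      rcases h1 with rfl | rfl
      · exact hz
      · simpa using hZ.neg_mem _ hz
  obtain ⟨i, hi⟩ := hZ.exists_pillar_eq_empty (by omega) hh hcov
  have hP := hZ.isPillars hh
  obtain ⟨b, hb, hort, hbcov⟩ := hP.exists_orthogonal_subset i
  -- The swap puts the possibly nonempty pillar over index `0`, as the model requires.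
  set g : Fin 3 ⊕ b → E := Sum.elim (h ∘ Equiv.swap 0 i) (fun v => (v : E)) with hg
  have hgram : ∀ k l, inner ℝ (g k) (g l) =
      if k = l then (Sum.elim (fun _ => 1 / 3) (fun _ => 2 / 3) k : ℝ) else 0 := by
    rintro (k | k) (l | l)
    · simp [hg, hh]
    · simp only [hg, Sum.elim_inl, Sum.elim_inr, Function.comp_apply, reduceCtorEq, if_false]
      rw [real_inner_comm]; exact (hb l.2).2 _
    · simp only [hg, Sum.elim_inl, Sum.elim_inr, Function.comp_apply, reduceCtorEq, if_false]
      exact (hb k.2).2 _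
    · simp [hg, hort, -inner_self_eq_norm_sq_to_K]
  have hli : LinearIndependent ℝ g := by
    refine linearIndependent_of_ne_zero_of_inner_eq_zero (fun k h0 => ?_) (fun k l hkl => ?_)
    · have := hgram k k
      rw [h0, inner_zero_left, if_pos rfl] at this
      rcases k with k | k <;> norm_num at this
    · exact (hgram k l).trans (if_neg hkl)
  have hgZ : ∀ k, g k ∈ Submodule.span ℝ Z := by
    rintro (k | k)
    · exact hspan _
    · have h1 := Submodule.subset_span (R := ℝ) (hb k.2).1
      have := Submodule.sub_mem _ h1 (hspan i)
      simpa [hg] using this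
  have hgh : ∀ j, g (Sum.inl (Equiv.swap 0 i j)) = h j := by
    intro j; simp [hg]
  have hZg : Submodule.span ℝ Z = Submodule.span ℝ (Set.range g) := by
    apply le_antisymm
    · rw [Submodule.span_le]
      have hmem : ∀ j, h j ∈ Submodule.span ℝ (Set.range g) := fun j =>
        Submodule.subset_span ⟨_, hgh j⟩
      have hc : ∀ j, ∀ c ∈ pillar Z h j, c ∈ Submodule.span ℝ (Set.range g) := by
        intro j c hc
        have hji : j = i := by
          by_contra hji
          rw [hi j hji] at hc
          exact hc
        subst hji
        obtain ⟨v, hv, hcv⟩ := hbcov c hc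
        have hvm : v ∈ Submodule.span ℝ (Set.range g) :=
          Submodule.subset_span ⟨Sum.inr ⟨v, hv⟩, rfl⟩
        rcases hcv with rfl | rfl
        · exact hvm
        · exact Submodule.neg_mem _ hvm
      intro z hz
      rcases hcov z hz with ⟨ε, -, rfl⟩ | ⟨j, c, hcj, rfl | rfl⟩
      · exact Submodule.sum_mem _ fun j _ => Submodule.smul_mem _ _ (hmem j)
      · exact Submodule.add_mem _ (hmem j) (hc j c hcj)
      · exact Submodule.neg_mem _ (Submodule.add_mem _ (hmem j) (hc j c hcj))
    · rw [Submodule.span_le]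
      rintro _ ⟨k, rfl⟩
      exact hgZ k
  have hfin : Finite (Fin 3 ⊕ b) := hli.finite
  have : Finite b := Finite.of_injective (Sum.inr : b → Fin 3 ⊕ b) Sum.inr_injective
  have := Fintype.ofFinite b
  have hcard : Fintype.card b = 5 := by
    have h1 := finrank_span_eq_card hli
    rw [← hZg, hr, Fintype.card_sum, Fintype.card_fin] at h1
    omega
  let e : Fin 5 ≃ b := (Fintype.equivFinOfCardEq hcard).symm
  have hu0 : ∀ k, (g ∘ Sum.map id e) (Sum.inl k) = g (Sum.inl k) := fun k => rfl
  refine ⟨g ∘ Sum.map id e, ?_, fun k => hgZ _, fun z hz => ?_⟩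
  · intro k l
    rw [Function.comp_apply, Function.comp_apply, hgram]
    rcases k with k | k <;> rcases l with l | l <;> simp
  · rcases hcov z hz with ⟨ε, hε, rfl⟩ | ⟨j, c, hcj, hzc⟩
    · have hsum : ∑ j, ε j • h j =
          ∑ k, (ε ∘ Equiv.swap 0 i) k • (g ∘ Sum.map id e) (Sum.inl k) := by
        rw [← Equiv.sum_comp (Equiv.swap 0 i)]
        rfl
      rw [hsum]
      obtain ⟨o, ho⟩ := exists_modelVec_of_signs (g ∘ Sum.map id e)
        (ε := ε ∘ Equiv.swap 0 i) (fun k => hε _)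
      exact ⟨Sum.inl o, ho⟩
    · have hji : j = i := by
        by_contra hji
        rw [hi j hji] at hcj
        exact hcj
      subst hji
      obtain ⟨v, hv, hcv⟩ := hbcov c hcj
      have h0 : (g ∘ Sum.map id e) (Sum.inl 0) = h j := by simp [hg]
      have h1 : (g ∘ Sum.map id e) (Sum.inr (e.symm ⟨v, hv⟩)) = v := by simp [hg]
      rcases hcv with rfl | rfl
      · refine ⟨Sum.inr (e.symm ⟨c, hv⟩, true), ?_⟩
        rw [modelVec_inr, h0, h1]; simpa using hzc
      · refine ⟨Sum.inr (e.symm ⟨v, hv⟩, false), ?_⟩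
        rw [modelVec_inr, h0, h1]; simpa using hzc

end Model

/-! ### Linear algebra of model frames and of the Gram matrix without obtuse triples. -/

section Frames

variable {E : Type*} [NormedAddCommGroup E] [InnerProductSpace ℝ E]

theorem IsModelFrame.linearIndependent {u : Fin 3 ⊕ Fin 5 → E} (hu : IsModelFrame u) :
    LinearIndependent ℝ u := by
  refine linearIndependent_of_ne_zero_of_inner_eq_zero (fun k h0 => ?_) (fun k l hkl => ?_)
  · have := hu k k
    rw [h0, inner_zero_left, if_pos rfl] at this
    rcases k with k | k <;> norm_num at this
  · exact (hu k l).trans (if_neg hkl)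

theorem IsModelFrame.modelVec_injective {u : Fin 3 ⊕ Fin 5 → E} (hu : IsModelFrame u) :
    Function.Injective (modelVec u) := by
  intro a b hab
  by_contra hne
  have h1 := hu.modelVec_inner_of_ne hne
  rw [hab, hu.modelVec_self] at h1
  norm_num at h1

/-- The length of the vectors of a model frame. -/
noncomputable def modelLength : Fin 3 ⊕ Fin 5 → ℝ :=
  Sum.elim (fun _ => √(1 / 3)) (fun _ => √(2 / 3))

theorem modelLength_ne_zero (k : Fin 3 ⊕ Fin 5) : modelLength k ≠ 0 := by
  rcases k with k | k <;> simp [modelLength]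

theorem modelLength_mul_self (k : Fin 3 ⊕ Fin 5) :
    modelLength k * modelLength k = Sum.elim (fun _ => 1 / 3) (fun _ => 2 / 3) k := by
  rcases k with k | k <;> exact Real.mul_self_sqrt (by norm_num)

theorem IsModelFrame.exists_orthonormalBasis {u : Fin 3 ⊕ Fin 5 → E} (hu : IsModelFrame u)
    {W : Submodule ℝ E} (hW : ∀ k, u k ∈ W) (hr : Module.finrank ℝ W = 8) :
    ∃ b : OrthonormalBasis (Fin 3 ⊕ Fin 5) ℝ W, ∀ k, u k = modelLength k • (b k : E) := by
  have hon : Orthonormal ℝ (fun k => (modelLength k)⁻¹ • (⟨u k, hW k⟩ : W)) := by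
    rw [orthonormal_iff_ite]
    intro k l
    rw [real_inner_smul_left, real_inner_smul_right, Submodule.coe_inner]
    simp only [hu k l]
    split_ifs with h
    · subst h
      rw [← modelLength_mul_self]
      field_simp [modelLength_ne_zero k]
    · simp
  have : FiniteDimensional ℝ W := .of_finrank_pos (by omega)
  have hspan := hon.linearIndependent.span_eq_top_of_card_eq_finrank' (by simp [hr])
  refine ⟨OrthonormalBasis.mk hon hspan.ge, fun k => ?_⟩
  simp [smul_smul, modelLength_ne_zero k]

/-- Each frame vector is half a difference of two model vectors. -/
theorem IsModelFrame.span_range_modelVec_eq_top {u : Fin 3 ⊕ Fin 5 → E} (hu : IsModelFrame u)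
    (hr : Module.finrank ℝ E = 8) : Submodule.span ℝ (Set.range (modelVec u)) = ⊤ := by
  have : FiniteDimensional ℝ E := .of_finrank_pos (by omega)
  have htop := hu.linearIndependent.span_eq_top_of_card_eq_finrank' (by simp [hr])
  rw [eq_top_iff, ← htop, Submodule.span_le]
  have hm : ∀ a, modelVec u a ∈ Submodule.span ℝ (Set.range (modelVec u)) := fun a =>
    Submodule.subset_span ⟨a, rfl⟩
  rintro _ ⟨k | l, rfl⟩
  · have h : u (Sum.inl k) =
        (1 / 2 : ℝ) • (modelVec u (Sum.inl none) - modelVec u (Sum.inl (some k))) := by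
      rw [modelVec_inl, modelVec_inl]
      fin_cases k <;> simp [Fin.sum_univ_three] <;> module
    rw [h]
    exact Submodule.smul_mem _ _ (Submodule.sub_mem _ (hm _) (hm _))
  · have h : u (Sum.inr l) = (1 / 2 : ℝ) •
        (modelVec u (Sum.inr (l, true)) - modelVec u (Sum.inr (l, false))) := by
      rw [modelVec_inr, modelVec_inr]
      simp only [if_true, Bool.false_eq_true, if_false]
      module
    rw [h]
    exact Submodule.smul_mem _ _ (Submodule.sub_mem _ (hm _) (hm _))

/-- The Gram form is `1/3 * (∑ c)^2 + 2/3 * ∑ c^2`, which is positive definite. -/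
theorem linearIndependent_of_inner_eq_third {ι : Type*} {g : ι → E}
    (hself : ∀ i, inner ℝ (g i) (g i) = (1 : ℝ))
    (hne : ∀ i j, i ≠ j → inner ℝ (g i) (g j) = (1 / 3 : ℝ)) : LinearIndependent ℝ g := by
  classical
  rw [linearIndependent_iff']
  intro s c hc i hi
  have hg : ∀ i j, inner ℝ (g i) (g j) = (1 / 3 : ℝ) + if i = j then 2 / 3 else 0 := by
    intro i j
    split_ifs with h
    · rw [h, hself]; norm_num
    · rw [hne i j h]; norm_num
  have h0 : inner ℝ (∑ j ∈ s, c j • g j) (∑ j ∈ s, c j • g j) =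
      1 / 3 * (∑ j ∈ s, c j) ^ 2 + 2 / 3 * ∑ j ∈ s, c j ^ 2 := by
    rw [sq (∑ j ∈ s, c j), Finset.sum_mul_sum, Finset.mul_sum, Finset.mul_sum,
      ← Finset.sum_add_distrib, sum_inner]
    refine Finset.sum_congr rfl fun j hj => ?_
    rw [inner_sum]
    simp only [real_inner_smul_left, real_inner_smul_right, hg, mul_add, Finset.sum_add_distrib,
      mul_ite, mul_zero, Finset.sum_ite_eq, if_pos hj, Finset.mul_sum]
    congr 1
    · exact Finset.sum_congr rfl fun k _ => by ring
    · ring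
  rw [hc, inner_zero_left] at h0
  have h1 : c i ^ 2 ≤ ∑ j ∈ s, c j ^ 2 :=
    Finset.single_le_sum (f := fun j => c j ^ 2) (fun j _ => sq_nonneg _) hi
  have h2 := sq_nonneg (∑ j ∈ s, c j)
  exact pow_eq_zero_iff two_ne_zero |>.mp (le_antisymm (by linarith) (sq_nonneg (c i)))

end Frames

/-! ### Equiangular sets of rank 8: the bound and the case of equality. -/

namespace IsEquiangularSet

variable {n : ℕ} {X : Set (EuclideanSpace ℝ (Fin n))}

theorem isLineSystem (hX : IsEquiangularSet (1 / 3) X) :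
    IsLineSystem {z | z ∈ X ∨ -z ∈ X} := by
  have hself : ∀ x ∈ X, inner ℝ x x = (1 : ℝ) := by
    intro x hx
    rw [real_inner_self_eq_norm_sq, hX.norm_eq_one x hx]; norm_num
  have hin : ∀ x ∈ X, ∀ y ∈ X, x = y ∨ inner ℝ x y = (1 / 3 : ℝ) ∨ inner ℝ x y = (-1 / 3 : ℝ) := by
    intro x hx y hy
    rcases eq_or_ne x y with h | h
    · exact Or.inl h
    · rw [neg_div]; exact Or.inr (hX.inner_eq x hx y hy h)
  refine ⟨?_, ?_, ?_⟩
  · rintro z (h | h)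
    · exact Or.inr (by simpa using h)
    · exact Or.inl h
  · rintro z (h | h)
    · exact hself z h
    · simpa only [inner_neg_neg] using hself _ h
  · rintro z (hz | hz) w (hw | hw)
    · have := hin z hz w hw
      tauto
    · rcases hin z hz _ hw with h | h | h
      · exact Or.inr (Or.inl h)
      · rw [inner_neg_right] at h
        exact Or.inr (Or.inr (Or.inr (by linarith)))
      · rw [inner_neg_right] at h
        exact Or.inr (Or.inr (Or.inl (by linarith)))
    · rcases hin _ hz w hw with h | h | h
      · exact Or.inr (Or.inl (by rw [← h, neg_neg]))
      · rw [inner_neg_left] at h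
        exact Or.inr (Or.inr (Or.inr (by linarith)))
      · rw [inner_neg_left] at h
        exact Or.inr (Or.inr (Or.inl (by linarith)))
    · rcases hin _ hz _ hw with h | h | h
      · exact Or.inl (neg_injective h)
      · rw [inner_neg_neg] at h
        exact Or.inr (Or.inr (Or.inl h))
      · rw [inner_neg_neg] at h
        exact Or.inr (Or.inr (Or.inr h))

theorem span_union_neg (X : Set (EuclideanSpace ℝ (Fin n))) :
    Submodule.span ℝ {z | z ∈ X ∨ -z ∈ X} = Submodule.span ℝ X := by
  apply le_antisymm
  · rw [Submodule.span_le]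
    rintro z (h | h)
    · exact Submodule.subset_span h
    · have := Submodule.neg_mem _ (Submodule.subset_span (R := ℝ) h)
      rwa [neg_neg] at this
  · exact Submodule.span_mono fun z hz => Or.inl hz

/-- If no three lines have an obtuse representation, the lines are linearly independent. -/
theorem encard_le_finrank (hX : IsEquiangularSet (1 / 3) X)
    (hno : ∀ x y t, (x ∈ X ∨ -x ∈ X) → (y ∈ X ∨ -y ∈ X) → (t ∈ X ∨ -t ∈ X) →
      inner ℝ x y = (-1 / 3 : ℝ) → inner ℝ x t = (-1 / 3 : ℝ) → inner ℝ y t ≠ (-1 / 3 : ℝ)) :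
    X.encard ≤ Set.finrank ℝ X := by
  classical
  rcases X.eq_empty_or_nonempty with rfl | ⟨x₀, hx₀⟩
  · simp
  have hZ := hX.isLineSystem
  have hsgn : ∀ x : X, ∃ s : ℝ, (s = 1 ∨ s = -1) ∧
      ((x : EuclideanSpace ℝ (Fin n)) = x₀ → s = 1) ∧
      ((x : EuclideanSpace ℝ (Fin n)) ≠ x₀ → inner ℝ x₀ (s • (x : EuclideanSpace ℝ (Fin n))) =
        (1 / 3 : ℝ)) := by
    intro x
    by_cases h : (x : EuclideanSpace ℝ (Fin n)) = x₀
    · exact ⟨1, Or.inl rfl, fun _ => rfl, fun h' => absurd h h'⟩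
    · rcases hX.inner_eq x₀ hx₀ x x.2 (Ne.symm h) with h1 | h1
      · exact ⟨1, Or.inl rfl, fun _ => rfl, fun _ => by rw [one_smul, h1]⟩
      · refine ⟨-1, Or.inr rfl, fun h' => absurd h' h, fun _ => ?_⟩
        rw [real_inner_smul_right, h1]; norm_num
  choose s hs hs0 hs1 using hsgn
  have hmem : ∀ x : X, s x • (x : EuclideanSpace ℝ (Fin n)) ∈ X ∨
      -(s x • (x : EuclideanSpace ℝ (Fin n))) ∈ X := by
    intro x
    rcases hs x with h | h <;> rw [h]
    · left; simp
    · right; simp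
  have hli : LinearIndependent ℝ (fun x : X => s x • (x : EuclideanSpace ℝ (Fin n))) := by
    refine linearIndependent_of_inner_eq_third (fun x => hZ.self _ (hmem x)) fun x y hxy => ?_
    have hxy' : (x : EuclideanSpace ℝ (Fin n)) ≠ y := fun h => hxy (Subtype.ext h)
    by_cases hx : (x : EuclideanSpace ℝ (Fin n)) = x₀
    · rw [hs0 x hx, one_smul, hx]
      exact hs1 y fun h => hxy' (hx.trans h.symm)
    by_cases hy : (y : EuclideanSpace ℝ (Fin n)) = x₀
    · rw [hs0 y hy, one_smul, hy, real_inner_comm]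
      exact hs1 x hx
    have hval : inner ℝ (s x • (x : EuclideanSpace ℝ (Fin n)))
        (s y • (y : EuclideanSpace ℝ (Fin n))) = (1 / 3 : ℝ) ∨
        inner ℝ (s x • (x : EuclideanSpace ℝ (Fin n)))
        (s y • (y : EuclideanSpace ℝ (Fin n))) = (-1 / 3 : ℝ) := by
      rw [real_inner_smul_left, real_inner_smul_right]
      rcases hX.inner_eq x x.2 y y.2 hxy' with h | h <;> rcases hs x with h1 | h1 <;>
        rcases hs y with h2 | h2 <;> rw [h, h1, h2] <;> norm_num
    -- With signs normalised against `x₀`, an inner product `-1/3` between two others would complete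
    -- a forbidden triple with `-x₀`.
    refine hval.resolve_right (hno (-x₀) _ _ (Or.inr (by simpa using hx₀)) (hmem x) (hmem y) ?_ ?_)
    · rw [inner_neg_left, hs1 x hx]; norm_num
    · rw [inner_neg_left, hs1 y hy]; norm_num
  have : Finite X := hli.finite
  have := Fintype.ofFinite X
  have h1 := finrank_span_eq_card hli
  have hle : Submodule.span ℝ (Set.range fun x : X => s x • (x : EuclideanSpace ℝ (Fin n))) ≤
      Submodule.span ℝ X := by
    rw [Submodule.span_le]
    rintro _ ⟨x, rfl⟩
    exact Submodule.smul_mem _ _ (Submodule.subset_span x.2)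
  have h2 := Submodule.finrank_mono hle
  rw [h1] at h2
  rw [← Set.coe_fintypeCard]
  exact_mod_cast h2

theorem encard_le_or_exists_modelFrame (hX : IsEquiangularSet (1 / 3) X)
    (hr : Set.finrank ℝ X = 8) :
    X.encard ≤ 8 ∨ ∃ u : Fin 3 ⊕ Fin 5 → EuclideanSpace ℝ (Fin n), IsModelFrame u ∧
      (∀ k, u k ∈ Submodule.span ℝ X) ∧
      ∀ x ∈ X, ∃ a, x = modelVec u a ∨ x = -modelVec u a := by
  by_cases h : ∀ x y t, (x ∈ X ∨ -x ∈ X) → (y ∈ X ∨ -y ∈ X) → (t ∈ X ∨ -t ∈ X) →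
      inner ℝ x y = (-1 / 3 : ℝ) → inner ℝ x t = (-1 / 3 : ℝ) → inner ℝ y t ≠ (-1 / 3 : ℝ)
  · left
    have := hX.encard_le_finrank h
    rw [hr] at this
    exact_mod_cast this
  · right
    push Not at h
    obtain ⟨x, y, t, hx, hy, ht, hxy, hxt, hyt⟩ := h
    obtain ⟨u, hu, hspan, hcov⟩ := hX.isLineSystem.exists_modelFrame
      (by rw [span_union_neg]; exact hr) hx hy ht hxy hxt hyt
    rw [span_union_neg] at hspan
    exact ⟨u, hu, hspan, fun x hx => hcov x (Or.inl hx)⟩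

/-- Two members with the same index are equal or opposite, and opposite unit vectors have inner
product `-1`. -/
theorem exists_injective_index (hX : IsEquiangularSet (1 / 3) X)
    {u : Fin 3 ⊕ Fin 5 → EuclideanSpace ℝ (Fin n)}
    (hcov : ∀ x ∈ X, ∃ a, x = modelVec u a ∨ x = -modelVec u a) :
    ∃ f : X → Option (Fin 3) ⊕ Fin 5 × Bool, Function.Injective f ∧
      ∀ x : X, (x : EuclideanSpace ℝ (Fin n)) = modelVec u (f x) ∨
        (x : EuclideanSpace ℝ (Fin n)) = -modelVec u (f x) := by
  choose f hf using fun x : X => hcov x x.2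
  refine ⟨f, fun x y hxy => ?_, hf⟩
  by_contra hne
  have hne' : (x : EuclideanSpace ℝ (Fin n)) ≠ y := fun h => hne (Subtype.ext h)
  have hyneg : (x : EuclideanSpace ℝ (Fin n)) = -y := by
    have hx := hf x
    rw [hxy] at hx
    rcases hx with hx | hx <;> rcases hf y with hy | hy
    · exact absurd (hx.trans hy.symm) hne'
    · rw [hx, hy, neg_neg]
    · rw [hx, hy]
    · exact absurd (hx.trans hy.symm) hne'
  have h1 := hX.inner_eq x x.2 y y.2 hne'
  rw [hyneg, inner_neg_left, real_inner_self_eq_norm_sq, hX.norm_eq_one y y.2] at h1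
  norm_num at h1

theorem encard_le_fourteen (hX : IsEquiangularSet (1 / 3) X) (hr : Set.finrank ℝ X = 8) :
    X.encard ≤ 14 := by
  rcases hX.encard_le_or_exists_modelFrame hr with h | ⟨u, -, -, hcov⟩
  · exact h.trans (by norm_num)
  · obtain ⟨f, hf, -⟩ := hX.exists_injective_index hcov
    have h := ENat.card_le_card_of_injective hf
    rw [ENat.card_coe_set_eq, ENat.card_eq_coe_fintype_card] at h
    exact h

/-- Fourteen equiangular lines of rank eight are the lines of the model. -/
theorem exists_modelFrame_of_encard_eq (hX : IsEquiangularSet (1 / 3) X)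
    (hr : Set.finrank ℝ X = 8) (hc : X.encard = 14) :
    ∃ u : Fin 3 ⊕ Fin 5 → EuclideanSpace ℝ (Fin n), IsModelFrame u ∧
      (∀ k, u k ∈ Submodule.span ℝ X) ∧
      ∀ v, (v ∈ X ∨ -v ∈ X) ↔ ∃ a, v = modelVec u a ∨ v = -modelVec u a := by
  rcases hX.encard_le_or_exists_modelFrame hr with h | ⟨u, hu, hspan, hcov⟩
  · rw [hc] at h
    exact absurd h (by norm_num)
  obtain ⟨f, hf, hfv⟩ := hX.exists_injective_index hcov
  have : Finite X := Finite.of_injective f hf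
  have := Fintype.ofFinite X
  have hcard : Fintype.card X = 14 := by
    rw [← Set.coe_fintypeCard] at hc
    exact_mod_cast hc
  -- The index type also has `4 + 5 * 2 = 14` elements, so no model line is missed.
  have hsurj := ((Fintype.bijective_iff_injective_and_card f).mpr ⟨hf, by rw [hcard]; rfl⟩).2
  refine ⟨u, hu, hspan, fun v => ⟨?_, ?_⟩⟩
  · rintro (h | h)
    · exact hcov v h
    · obtain ⟨a, ha | ha⟩ := hcov _ h
      · exact ⟨a, Or.inr (by rw [← ha, neg_neg])⟩
      · exact ⟨a, Or.inl (neg_injective ha)⟩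
  · rintro ⟨a, ha⟩
    obtain ⟨x, rfl⟩ := hsurj a
    have hx := x.2
    rcases hfv x with h | h <;> rcases ha with h' | h' <;> rw [h] at hx <;> rw [h']
    · exact Or.inl hx
    · exact Or.inr (by rwa [neg_neg])
    · exact Or.inr hx
    · exact Or.inl hx

end IsEquiangularSet

/-! ### Existence and uniqueness of the maximum configuration. -/

theorem exists_equiangular_fourteen : ∃ X : Set (EuclideanSpace ℝ (Fin 8)),
    IsEquiangularSet (1 / 3) X ∧ Set.finrank ℝ X = 8 ∧ X.encard = 14 := by
  set u : Fin 3 ⊕ Fin 5 → EuclideanSpace ℝ (Fin 8) := fun k =>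
    modelLength k • EuclideanSpace.basisFun (Fin 8) ℝ (finSumFinEquiv k) with hudef
  have hu : IsModelFrame u := by
    intro k l
    have h := orthonormal_iff_ite.mp (EuclideanSpace.basisFun (Fin 8) ℝ).orthonormal
      (finSumFinEquiv k) (finSumFinEquiv l)
    rw [hudef, real_inner_smul_left, real_inner_smul_right, h]
    simp only [EmbeddingLike.apply_eq_iff_eq]
    split_ifs with hkl
    · rw [← hkl, mul_one, modelLength_mul_self]
    · simp
  refine ⟨Set.range (modelVec u), ⟨by norm_num, by norm_num, ?_, ?_⟩, ?_, ?_⟩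
  · rintro _ ⟨a, rfl⟩
    rw [norm_eq_sqrt_real_inner, hu.modelVec_self, Real.sqrt_one]
  · rintro _ ⟨a, rfl⟩ _ ⟨b, rfl⟩ hab
    exact hu.modelVec_inner_of_ne fun h => hab (by rw [h])
  · rw [Set.finrank, hu.span_range_modelVec_eq_top (by simp), finrank_top]
    simp
  · rw [← Set.image_univ, hu.modelVec_injective.encard_image, Set.encard_univ,
      ENat.card_eq_coe_fintype_card]
    rfl

/-- Both frames rescale by the same lengths to orthonormal bases of the spans. The isometry matching
these bases preserves coordinates, hence sends each model vector to the one with the same index. -/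
theorem linesIsomorphic_of_modelFrame {m n : ℕ} {X : Set (EuclideanSpace ℝ (Fin m))}
    {Y : Set (EuclideanSpace ℝ (Fin n))} (hX : Set.finrank ℝ X = 8) (hY : Set.finrank ℝ Y = 8)
    {u : Fin 3 ⊕ Fin 5 → EuclideanSpace ℝ (Fin m)} {w : Fin 3 ⊕ Fin 5 → EuclideanSpace ℝ (Fin n)}
    (hu : IsModelFrame u) (hw : IsModelFrame w) (huX : ∀ k, u k ∈ Submodule.span ℝ X)
    (hwY : ∀ k, w k ∈ Submodule.span ℝ Y)
    (hXu : ∀ v, (v ∈ X ∨ -v ∈ X) ↔ ∃ a, v = modelVec u a ∨ v = -modelVec u a)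
    (hYw : ∀ v, (v ∈ Y ∨ -v ∈ Y) ↔ ∃ a, v = modelVec w a ∨ v = -modelVec w a) :
    LinesIsomorphic X Y := by
  obtain ⟨b, hb⟩ := hu.exists_orthonormalBasis huX hX
  obtain ⟨c, hc⟩ := hw.exists_orthonormalBasis hwY hY
  refine ⟨b.equiv c (Equiv.refl _), fun v => ?_⟩
  rw [hXu, hYw]
  refine exists_congr fun a => ?_
  set p : Submodule.span ℝ X := ∑ k, (modelCoeff a k : ℝ) • modelLength k • b k with hp
  have hpu : modelVec u a = p := by
    simp [modelVec, hb, hp]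
  have hpw : modelVec w a = b.equiv c (Equiv.refl _) p := by
    simp [modelVec, hc, hp]
  rw [hpu, hpw, ← Submodule.coe_neg, ← Submodule.coe_neg, ← map_neg]
  simp only [SetLike.coe_eq_coe, EmbeddingLike.apply_eq_iff_eq]

theorem mainTheorem6 :
    (∀ (n : ℕ) (X : Set (EuclideanSpace ℝ (Fin n))),
      IsEquiangularSet (1 / 3) X → Set.finrank ℝ X = 8 → X.encard ≤ 14) ∧
    (∃ X : Set (EuclideanSpace ℝ (Fin 8)),
      IsEquiangularSet (1 / 3) X ∧ Set.finrank ℝ X = 8 ∧ X.encard = 14) ∧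
    (∀ (m n : ℕ) (X : Set (EuclideanSpace ℝ (Fin m))) (Y : Set (EuclideanSpace ℝ (Fin n))),
      IsEquiangularSet (1 / 3) X → Set.finrank ℝ X = 8 → X.encard = 14 →
      IsEquiangularSet (1 / 3) Y → Set.finrank ℝ Y = 8 → Y.encard = 14 →
      LinesIsomorphic X Y) := by
  refine ⟨fun n X hX hr => hX.encard_le_fourteen hr, exists_equiangular_fourteen, ?_⟩
  intro m n X Y hX hrX hcX hY hrY hcY
  obtain ⟨u, hu, huX, hXu⟩ := hX.exists_modelFrame_of_encard_eq hrX hcX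
  obtain ⟨w, hw, hwY, hYw⟩ := hY.exists_modelFrame_of_encard_eq hrY hcY
  exact linesIsomorphic_of_modelFrame hrX hrY hu hw huX hwY hXu hYw
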